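/- Fix a first-order vocabulary of unary predicate symbols, binary relation symbols and function symbols of all arities (constants being the nullary ones). \emph{$\mathrm{PDL}^+$.} Programs and formulas are generated by $\alpha,\beta ::= a \mid \alpha;\beta \mid \alpha\cup\beta \mid \alpha^+$ and $A,B ::= p \mid \bar p \mid A\wedge B \mid A\vee B \mid [\alpha]A \mid \langle\alpha\rangle A$, for relation symbols $a$ and predicate symbols $p$. We write $\alpha\beta$ for $\alpha;\beta$; $\bar A$ is the De Morgan dual and $A\to B := \bar A\vee B$. In a structure, programs denote binary relations (composition, union, transitive closure) and $[\alpha],\langle\alpha\rangle$ are the usual modalities; $A$ is \emph{valid} if it holds at every point of every structure. \emph{$\mathrm{TCL}$.} Formulas are first-order formulas with equality in negation normal form, extended by $TC(\lambda x,y.A)(s,t)$ (transitive closure) and its dual $\overline{TC}(\lambda x,y.A)(s,t)$. The standard translation is $\mathsf{ST}_{x,y}(a)=a(x,y)$, $\mathsf{ST}_{x,y}(\alpha\cup\beta)=\mathsf{ST}_{x,y}(\alpha)\vee\mathsf{ST}_{x,y}(\beta)$, $\mathsf{ST}_{x,y}(\alpha;\beta)=\exists z(\mathsf{ST}_{x,z}(\alpha)\wedge\mathsf{ST}_{z,y}(\beta))$,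 $\mathsf{ST}_{x,y}(\alpha^+)=TC(\lambda x,y.\mathsf{ST}_{x,y}(\alpha))(x,y)$; $\mathsf{ST}_x(p)=p(x)$, $\mathsf{ST}_x(\bar p)=\bar p(x)$, commuting with $\wedge,\vee$; $\mathsf{ST}_x(\langle\alpha\rangle A)=\exists y(\mathsf{ST}_{x,y}(\alpha)\wedge\mathsf{ST}_y(A))$ and $\mathsf{ST}_x([\alpha]A)=\forall y(\overline{\mathsf{ST}_{x,y}(\alpha)}\vee\mathsf{ST}_y(A))$. We write $\mathsf{ST}_t(A)$ for its instance at a term $t$. \emph{The cut-free system $\mathrm{TCL}_G$.} Sequents are finite sets of formulas; $\Gamma, A$ denotes $\Gamma\cup\{A\}$ (so $\Gamma$ may contain $A$). The rules, with the premisses before the conclusion, are: \begin{itemize} \item axioms $\Gamma,P,\bar P$ (with $P$ of the form $p(t)$ or $a(s,t)$) and $\Gamma,t=t$; \item $\Gamma,A_i\,/\,\Gamma,A_0\vee A_1$ for $i\in\{0,1\}$; $\Gamma,A$ and $\Gamma,B\,/\,\Gamma,A\wedge B$; $\Gamma,A(t)\,/\,\Gamma,\exists xA(x)$; $\Gamma,A(c)\,/\,\Gamma,\forall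 xA(x)$ with $c$ a constant not occurring in the conclusion; \item weakening $\Gamma\,/\,\Gamma,\Gamma'$; $\Gamma,A(t)\,/\,\Gamma,s\neq t,A(s)$; $\Gamma,A(s)\,/\,\Gamma,s\neq t,A(t)$; substitution $\Gamma\,/\,\sigma(\Gamma)$, where $\sigma$ maps constants to terms and other function symbols to function symbols of the same arity; \item $\Gamma,A(s,t)\,/\,\Gamma,TC(A)(s,t)$; $\Gamma,A(s,r)$ and $\Gamma,TC(A)(r,t)\,/\,\Gamma,TC(A)(s,t)$; and $\Gamma,A(s,t)$ and $\Gamma,A(s,c),\overline{TC}(A)(c,t)\,/\,\Gamma,\overline{TC}(A)(s,t)$ with $c$ a constant not occurring in the conclusion. \end{itemize} There is no cut rule. A \emph{preproof} is a possibly infinite tree generated by the rules; it is \emph{regular} if it has only finitely many distinct sub-preproofs. A \emph{trace} along an infinite branch $(\mathsf r_i)_{i\in\mathbb N}$ is a sequence, from some index $k$ on, of formulas $\overline{TC}(A_i)(s_i,t_i)$ in the conclusions of $\mathsf r_i$ such that for every $i\ge k$: (1) $\mathsf r_i$ is not a substitution step and the formula stays the same; or (2) $\mathsf r_i$ is a $\overline{TC}$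 step with principal formula $\overline{TC}(A_i)(s_i,t_i)$ and eigenvariable $c$, and $A_{i+1}=A_i$, $s_{i+1}=c$, $t_{i+1}=t_i$; or (3) $\mathsf r_i$ is a substitution step for $\sigma$ and $(\sigma(A_{i+1}),\sigma(s_{i+1}),\sigma(t_{i+1}))=(A_i,s_i,t_i)$. A \emph{cyclic proof} is a regular preproof in which every infinite branch has a trace where case (2) happens infinitely often. \textbf{Theorem (Incompleteness).} Let $a\neq b$ be relation symbols, let $p$ be a predicate symbol, and let $A$ be the $\mathrm{PDL}^+$ formula $$\langle (aa\cup aba)^+\rangle p \;\to\; \langle a^+((ba^+)^+\cup a)\rangle p .$$ Then $A$ is valid, but for every term $t$ (in particular for every variable and for every constant) the formula $\mathsf{ST}_t(A)$ has no cyclic proof in the cut-free system $\mathrm{TCL}_G$. -/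

import Mathlib

universe u

/-- A first-order vocabulary: unary predicate symbols, binary relation symbols, and function
symbols of every arity (constant symbols are the function symbols of arity `0`). -/
structure Vocab where
  Pr : Type
  Rel : Type
  Fn : ℕ → Type

/-! ### Terms and formulas of transitive closure logic

Free variables are named by natural numbers.  Bound variables are de Bruijn levels: in `Tm V n`
and `Fm V n` there are `n` enclosing binders, the innermost one being `Fin.last`.  So formulas
are taken up to renaming of bound variables, and substitution is capture-avoiding.  The terms and
formulas of the logic itself are those with `n = 0`. -/

inductive Tm (V : Vocab) (n : ℕ) : Type
  | free (x : ℕ) : Tm V n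
  | bound (i : Fin n) : Tm V n
  | app {k : ℕ} (f : V.Fn k) (ts : Fin k → Tm V n) : Tm V n

/-- The term consisting of a constant symbol. -/
def Tm.const {V : Vocab} {n : ℕ} (c : V.Fn 0) : Tm V n := Tm.app c Fin.elim0

/-- Simultaneous substitution of terms for the bound variables. -/
def Tm.bind {V : Vocab} {n m : ℕ} (τ : Fin n → Tm V m) : Tm V n → Tm V m
  | .free x => .free x
  | .bound i => τ i
  | .app f ts => .app f (fun j => (ts j).bind τ)

/-- View a term under one more binder. -/
def Tm.lift {V : Vocab} {n : ℕ} (t : Tm V n) : Tm V (n + 1) :=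
  t.bind (fun i => .bound i.castSucc)

/-- Extend a substitution under one more binder. -/
def Tm.up {V : Vocab} {n m : ℕ} (τ : Fin n → Tm V m) : Fin (n + 1) → Tm V (m + 1) :=
  Fin.snoc (α := fun _ => Tm V (m + 1)) (fun i => (τ i).lift) (.bound (Fin.last m))

/-- Formulas, in negation normal form.  In `tc A s t` and `cotc A s t` the body `A` stands for
`λ x y. A`, with `x` the outer and `y` the inner of the two bound variables. -/
inductive Fm (V : Vocab) : ℕ → Type
  | pred {n : ℕ} (p : V.Pr) (t : Tm V n) : Fm V n
  | npred {n : ℕ} (p : V.Pr) (t : Tm V n) : Fm V n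
  | rel {n : ℕ} (a : V.Rel) (s t : Tm V n) : Fm V n
  | nrel {n : ℕ} (a : V.Rel) (s t : Tm V n) : Fm V n
  | eq {n : ℕ} (s t : Tm V n) : Fm V n
  | neq {n : ℕ} (s t : Tm V n) : Fm V n
  | and {n : ℕ} (A B : Fm V n) : Fm V n
  | or {n : ℕ} (A B : Fm V n) : Fm V n
  | all {n : ℕ} (A : Fm V (n + 1)) : Fm V n
  | ex {n : ℕ} (A : Fm V (n + 1)) : Fm V n
  | tc {n : ℕ} (A : Fm V (n + 2)) (s t : Tm V n) : Fm V n
  | cotc {n : ℕ} (A : Fm V (n + 2)) (s t : Tm V n) : Fm V n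

/-- The complement of a formula. -/
def Fm.dual {V : Vocab} {n : ℕ} : Fm V n → Fm V n
  | .pred p t => .npred p t
  | .npred p t => .pred p t
  | .rel a s t => .nrel a s t
  | .nrel a s t => .rel a s t
  | .eq s t => .neq s t
  | .neq s t => .eq s t
  | .and A B => .or A.dual B.dual
  | .or A B => .and A.dual B.dual
  | .all A => .ex A.dual
  | .ex A => .all A.dual
  | .tc A s t => .cotc A.dual s t
  | .cotc A s t => .tc A.dual s t

/-- Simultaneous substitution of terms for the bound variables. -/
def Fm.bind {V : Vocab} {n m : ℕ} (τ : Fin n → Tm V m) : Fm V n → Fm V m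
  | .pred p t => .pred p (t.bind τ)
  | .npred p t => .npred p (t.bind τ)
  | .rel a s t => .rel a (s.bind τ) (t.bind τ)
  | .nrel a s t => .nrel a (s.bind τ) (t.bind τ)
  | .eq s t => .eq (s.bind τ) (t.bind τ)
  | .neq s t => .neq (s.bind τ) (t.bind τ)
  | .and A B => .and (A.bind τ) (B.bind τ)
  | .or A B => .or (A.bind τ) (B.bind τ)
  | .all A => .all (A.bind (Tm.up τ))
  | .ex A => .ex (A.bind (Tm.up τ))
  | .tc A s t => .tc (A.bind (Tm.up (Tm.up τ))) (s.bind τ) (t.bind τ)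
  | .cotc A s t => .cotc (A.bind (Tm.up (Tm.up τ))) (s.bind τ) (t.bind τ)

/-- `A(t)` for a body `A(x)`. -/
def Fm.inst {V : Vocab} (A : Fm V 1) (t : Tm V 0) : Fm V 0 := A.bind (fun _ => t)

/-- `A(s, t)` for a body `A(x, y)`. -/
def Fm.inst₂ {V : Vocab} (A : Fm V 2) (s t : Tm V 0) : Fm V 0 := A.bind ![s, t]

/-- The constant symbol `c` occurs in the term. -/
def Tm.HasConst {V : Vocab} {n : ℕ} (c : V.Fn 0) : Tm V n → Prop
  | .free _ => False
  | .bound _ => False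
  | @Tm.app _ _ 0 f _ => f = c
  | @Tm.app _ _ (_ + 1) _ ts => ∃ j, (ts j).HasConst c

/-- The constant symbol `c` occurs in the formula. -/
def Fm.HasConst {V : Vocab} (c : V.Fn 0) {n : ℕ} : Fm V n → Prop
  | .pred _ t => t.HasConst c
  | .npred _ t => t.HasConst c
  | .rel _ s t => s.HasConst c ∨ t.HasConst c
  | .nrel _ s t => s.HasConst c ∨ t.HasConst c
  | .eq s t => s.HasConst c ∨ t.HasConst c
  | .neq s t => s.HasConst c ∨ t.HasConst c
  | .and A B => A.HasConst c ∨ B.HasConst c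
  | .or A B => A.HasConst c ∨ B.HasConst c
  | .all A => A.HasConst c
  | .ex A => A.HasConst c
  | .tc A s t => A.HasConst c ∨ s.HasConst c ∨ t.HasConst c
  | .cotc A s t => A.HasConst c ∨ s.HasConst c ∨ t.HasConst c

/-- A substitution: constant symbols are mapped to terms, and function symbols of positive arity
to function symbols of the same arity. -/
structure Substn (V : Vocab) where
  const : V.Fn 0 → Tm V 0
  fn : ∀ k : ℕ, V.Fn (k + 1) → V.Fn (k + 1)

/-- Action of a substitution on terms. -/
def Tm.act {V : Vocab} (σ : Substn V) {n : ℕ} : Tm V n → Tm V n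
  | .free x => .free x
  | .bound i => .bound i
  | @Tm.app _ _ 0 c _ => (σ.const c).bind Fin.elim0
  | @Tm.app _ _ (k + 1) f ts => .app (σ.fn k f) (fun j => (ts j).act σ)

/-- Action of a substitution on formulas. -/
def Fm.act {V : Vocab} (σ : Substn V) {n : ℕ} : Fm V n → Fm V n
  | .pred p t => .pred p (t.act σ)
  | .npred p t => .npred p (t.act σ)
  | .rel a s t => .rel a (s.act σ) (t.act σ)
  | .nrel a s t => .nrel a (s.act σ) (t.act σ)
  | .eq s t => .eq (s.act σ) (t.act σ)
  | .neq s t => .neq (s.act σ) (t.act σ)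
  | .and A B => .and (A.act σ) (B.act σ)
  | .or A B => .or (A.act σ) (B.act σ)
  | .all A => .all (A.act σ)
  | .ex A => .ex (A.act σ)
  | .tc A s t => .tc (A.act σ) (s.act σ) (t.act σ)
  | .cotc A s t => .cotc (A.act σ) (s.act σ) (t.act σ)

/-! ### The cut-free sequent system with transitive closure -/

/-- `c` does not occur in the sequent `Γ`. -/
def Fresh {V : Vocab} (c : V.Fn 0) (Γ : Set (Fm V 0)) : Prop := ∀ B ∈ Γ, ¬ B.HasConst c

/-- Instances of the inference rules.  `insert A Γ` is the sequent `Γ, A`; the context `Γ` may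
itself contain the principal formula.  There is no cut rule. -/
inductive Inference (V : Vocab) : Type
  | idPred (Γ : Set (Fm V 0)) (p : V.Pr) (t : Tm V 0)
  | idRel (Γ : Set (Fm V 0)) (a : V.Rel) (s t : Tm V 0)
  | or₀ (Γ : Set (Fm V 0)) (A B : Fm V 0)
  | or₁ (Γ : Set (Fm V 0)) (A B : Fm V 0)
  | and (Γ : Set (Fm V 0)) (A B : Fm V 0)
  | ex (Γ : Set (Fm V 0)) (A : Fm V 1) (t : Tm V 0)
  | all (Γ : Set (Fm V 0)) (A : Fm V 1) (c : V.Fn 0) (fresh : Fresh c (insert (.all A) Γ))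
  | wk (Γ Γ' : Set (Fm V 0))
  | eqRefl (Γ : Set (Fm V 0)) (t : Tm V 0)
  | neq₀ (Γ : Set (Fm V 0)) (A : Fm V 1) (s t : Tm V 0)
  | neq₁ (Γ : Set (Fm V 0)) (A : Fm V 1) (s t : Tm V 0)
  | subst (σ : Substn V) (Γ : Set (Fm V 0))
  | tc₀ (Γ : Set (Fm V 0)) (A : Fm V 2) (s t : Tm V 0)
  | tc₁ (Γ : Set (Fm V 0)) (A : Fm V 2) (s r t : Tm V 0)
  | cotc (Γ : Set (Fm V 0)) (A : Fm V 2) (s t : Tm V 0) (c : V.Fn 0)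
      (fresh : Fresh c (insert (.cotc A s t) Γ))

/-- The conclusion of an inference. -/
def Inference.concl {V : Vocab} : Inference V → Set (Fm V 0)
  | .idPred Γ p t => insert (.pred p t) (insert (.npred p t) Γ)
  | .idRel Γ a s t => insert (.rel a s t) (insert (.nrel a s t) Γ)
  | .or₀ Γ A B => insert (.or A B) Γ
  | .or₁ Γ A B => insert (.or A B) Γ
  | .and Γ A B => insert (.and A B) Γ
  | .ex Γ A _ => insert (.ex A) Γ
  | .all Γ A _ _ => insert (.all A) Γ
  | .wk Γ Γ' => Γ ∪ Γ'
  | .eqRefl Γ t => insert (.eq t t) Γ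
  | .neq₀ Γ A s t => insert (.neq s t) (insert (A.inst s) Γ)
  | .neq₁ Γ A s t => insert (.neq s t) (insert (A.inst t) Γ)
  | .subst σ Γ => Fm.act σ '' Γ
  | .tc₀ Γ A s t => insert (.tc A s t) Γ
  | .tc₁ Γ A s _ t => insert (.tc A s t) Γ
  | .cotc Γ A s t _ _ => insert (.cotc A s t) Γ

/-- The premisses of an inference, from left to right. -/
def Inference.prems {V : Vocab} : Inference V → List (Set (Fm V 0))
  | .idPred _ _ _ => []
  | .idRel _ _ _ _ => []
  | .or₀ Γ A _ => [insert A Γ]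
  | .or₁ Γ _ B => [insert B Γ]
  | .and Γ A B => [insert A Γ, insert B Γ]
  | .ex Γ A t => [insert (A.inst t) Γ]
  | .all Γ A c _ => [insert (A.inst (.const c)) Γ]
  | .wk Γ _ => [Γ]
  | .eqRefl _ _ => []
  | .neq₀ Γ A _ t => [insert (A.inst t) Γ]
  | .neq₁ Γ A s _ => [insert (A.inst s) Γ]
  | .subst _ Γ => [Γ]
  | .tc₀ Γ A s t => [insert (A.inst₂ s t) Γ]
  | .tc₁ Γ A s r t => [insert (A.inst₂ s r) Γ, insert (.tc A r t) Γ]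
  | .cotc Γ A s t c _ =>
      [insert (A.inst₂ s t) Γ, insert (A.inst₂ s (.const c)) (insert (.cotc A (.const c) t) Γ)]

/-- A preproof: a possibly infinite tree of inferences on finite sequents.  Nodes are addressed
by lists of child indices, the root being `[]`; `infer w = none` means that there is no node at
the address `w`. -/
structure Preproof (V : Vocab) where
  infer : List ℕ → Option (Inference V)
  root : infer [] ≠ none
  child : ∀ (w : List ℕ) (r : Inference V), infer w = some r →
    ∀ i : ℕ, (infer (w ++ [i])).map Inference.concl = r.prems[i]?
  orphan : ∀ (w : List ℕ), infer w = none → ∀ i : ℕ, infer (w ++ [i]) = none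
  finite : ∀ (w : List ℕ) (r : Inference V), infer w = some r → r.concl.Finite

/-- The preproof has conclusion `Γ`. -/
def Preproof.Concludes {V : Vocab} (P : Preproof V) (Γ : Set (Fm V 0)) : Prop :=
  (P.infer []).map Inference.concl = some Γ

/-- There are only finitely many distinct sub-preproofs. -/
def Preproof.Regular {V : Vocab} (P : Preproof V) : Prop :=
  {T : List ℕ → Option (Inference V) |
    ∃ w : List ℕ, P.infer w ≠ none ∧ T = fun u => P.infer (w ++ u)}.Finite

/-- `π` (the successive child indices) and `r` (the successive inferences) describe an infinite
branch of the preproof, starting at the root. -/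
def Preproof.IsBranch {V : Vocab} (P : Preproof V) (π : ℕ → ℕ) (r : ℕ → Inference V) : Prop :=
  ∀ i : ℕ, P.infer ((List.range i).map π) = some (r i)

def Inference.IsSubst {V : Vocab} : Inference V → Prop
  | .subst _ _ => True
  | _ => False

/-- The data of a formula `cotc body src tgt` on a trace. -/
structure TraceFm (V : Vocab) where
  body : Fm V 2
  src : Tm V 0
  tgt : Tm V 0

def TraceFm.toFm {V : Vocab} (φ : TraceFm V) : Fm V 0 := .cotc φ.body φ.src φ.tgt

/-- The trace leaves the formula `φ` unchanged at a step that is not a substitution. -/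
def TraceStay {V : Vocab} (r : Inference V) (φ ψ : TraceFm V) : Prop :=
  ¬ r.IsSubst ∧ ψ = φ

/-- `φ` is principal at a step for the dual transitive closure, with eigenvariable `c`, and the
trace continues with source `c`. -/
def TraceProgress {V : Vocab} (r : Inference V) (φ ψ : TraceFm V) : Prop :=
  ∃ (Γ : Set (Fm V 0)) (c : V.Fn 0) (h : Fresh c (insert (.cotc φ.body φ.src φ.tgt) Γ)),
    r = .cotc Γ φ.body φ.src φ.tgt c h ∧ ψ = ⟨φ.body, .const c, φ.tgt⟩

/-- The trace follows a substitution step. -/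
def TraceSubst {V : Vocab} (r : Inference V) (φ ψ : TraceFm V) : Prop :=
  ∃ (σ : Substn V) (Γ : Set (Fm V 0)), r = .subst σ Γ ∧
    ψ.body.act σ = φ.body ∧ ψ.src.act σ = φ.src ∧ ψ.tgt.act σ = φ.tgt

/-- `φ` is, from position `k` on, a trace along the branch `r`. -/
def IsTrace {V : Vocab} (r : ℕ → Inference V) (k : ℕ) (φ : ℕ → TraceFm V) : Prop :=
  ∀ i ≥ k, (φ i).toFm ∈ (r i).concl ∧
    (TraceStay (r i) (φ i) (φ (i + 1)) ∨ TraceProgress (r i) (φ i) (φ (i + 1)) ∨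
      TraceSubst (r i) (φ i) (φ (i + 1)))

/-- Every infinite branch has a trace that progresses infinitely often. -/
def Preproof.IsProof {V : Vocab} (P : Preproof V) : Prop :=
  ∀ (π : ℕ → ℕ) (r : ℕ → Inference V), P.IsBranch π r →
    ∃ (k : ℕ) (φ : ℕ → TraceFm V), IsTrace r k φ ∧
      ∀ m : ℕ, ∃ i ≥ m, k ≤ i ∧ TraceProgress (r i) (φ i) (φ (i + 1))

/-- `A` has a cut-free cyclic proof. -/
def CyclicProvable {V : Vocab} (A : Fm V 0) : Prop :=
  ∃ P : Preproof V, P.Concludes {A} ∧ P.IsProof ∧ P.Regular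

/-! ### Identity-free propositional dynamic logic -/

inductive Prog (V : Vocab) : Type
  | atom (a : V.Rel) : Prog V
  | comp (α β : Prog V) : Prog V
  | union (α β : Prog V) : Prog V
  | plus (α : Prog V) : Prog V

inductive PDLFm (V : Vocab) : Type
  | pred (p : V.Pr) : PDLFm V
  | npred (p : V.Pr) : PDLFm V
  | and (A B : PDLFm V) : PDLFm V
  | or (A B : PDLFm V) : PDLFm V
  | box (α : Prog V) (A : PDLFm V) : PDLFm V
  | dia (α : Prog V) (A : PDLFm V) : PDLFm V

/-- The complement of a formula. -/
def PDLFm.dual {V : Vocab} : PDLFm V → PDLFm V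
  | .pred p => .npred p
  | .npred p => .pred p
  | .and A B => .or A.dual B.dual
  | .or A B => .and A.dual B.dual
  | .box α A => .dia α A.dual
  | .dia α A => .box α A.dual

/-- Implication, as an abbreviation. -/
def PDLFm.imp {V : Vocab} (A B : PDLFm V) : PDLFm V := .or A.dual B

/-- A structure with domain `D`. -/
structure Struct (V : Vocab) (D : Type*) where
  pred : V.Pr → Set D
  rel : V.Rel → Set (D × D)

/-- The binary relation denoted by a program. -/
def Prog.denote {V : Vocab} {D : Type*} (M : Struct V D) : Prog V → D → D → Prop
  | .atom a => fun u v => (u, v) ∈ M.rel a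
  | .comp α β => fun u v => ∃ w, α.denote M u w ∧ β.denote M w v
  | .union α β => fun u v => α.denote M u v ∨ β.denote M u v
  | .plus α => Relation.TransGen (α.denote M)

/-- Satisfaction at a point of a structure. -/
def PDLFm.Sat {V : Vocab} {D : Type*} (M : Struct V D) : D → PDLFm V → Prop
  | v, .pred p => v ∈ M.pred p
  | v, .npred p => v ∉ M.pred p
  | v, .and A B => A.Sat M v ∧ B.Sat M v
  | v, .or A B => A.Sat M v ∨ B.Sat M v
  | v, .box α A => ∀ w, α.denote M v w → A.Sat M w
  | v, .dia α A => ∃ w, α.denote M v w ∧ A.Sat M w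

/-- Validity: truth at every point of every structure. -/
def PDLFm.Valid {V : Vocab} (A : PDLFm V) : Prop :=
  ∀ (D : Type u) (M : Struct V D) (v : D), A.Sat M v

/-! ### The standard translation -/

/-- The standard translation of a program, at the terms `s` and `t`. -/
def Prog.st {V : Vocab} : Prog V → ∀ {n : ℕ}, Tm V n → Tm V n → Fm V n
  | .atom a, _, s, t => .rel a s t
  | .comp α β, n, s, t =>
      .ex (.and (α.st s.lift (.bound (Fin.last n))) (β.st (.bound (Fin.last n)) t.lift))
  | .union α β, _, s, t => .or (α.st s t) (β.st s t)
  | .plus α, n, s, t =>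
      .tc (α.st (.bound (Fin.last n).castSucc) (.bound (Fin.last (n + 1)))) s t

/-- The standard translation of a formula, at the term `t`. -/
def PDLFm.st {V : Vocab} : PDLFm V → ∀ {n : ℕ}, Tm V n → Fm V n
  | .pred p, _, t => .pred p t
  | .npred p, _, t => .npred p t
  | .and A B, _, t => .and (A.st t) (B.st t)
  | .or A B, _, t => .or (A.st t) (B.st t)
  | .dia α A, n, t =>
      .ex (.and (α.st t.lift (.bound (Fin.last n))) (A.st (.bound (Fin.last n))))
  | .box α A, n, t =>
      .all (.or (α.st t.lift (.bound (Fin.last n))).dual (A.st (.bound (Fin.last n))))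

/-- The formula `⟨(aa ∪ aba)⁺⟩p → ⟨a⁺((ba⁺)⁺ ∪ a)⟩p`. -/
def counterexample {V : Vocab} (a b : V.Rel) (p : V.Pr) : PDLFm V :=
  .imp
    (.dia (.plus (.union (.comp (.atom a) (.atom a))
      (.comp (.atom a) (.comp (.atom b) (.atom a))))) (.pred p))
    (.dia (.comp (.plus (.atom a))
      (.union (.plus (.comp (.atom b) (.plus (.atom a)))) (.atom a))) (.pred p))

/-! Validity: consider a path made of blocks `aa` and `aba`. If it has no `b`, it lies in `a⁺a`.
Otherwise split it before its first `b`: the part before is in `a⁺`, and since every `b` is followed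
by an `a`, the rest is in `(ba⁺)⁺`.

Unprovability: the splitting point depends on the whole path, and without cut no formula can record
that the current point is `a⁺`-reachable from the start. Only explicit edges `¬ a(x, y)` can, and a
regular preproof has finitely many sequents, each with boundedly many edges.

To exploit this, terms are labelled by points of a graph for `a`, with `b` empty and `p` true only
at `top`. The starting term sits at the origin of an infinite ray. The antecedent is read
nonstandardly: even points of the ray count as being at an even distance from `top`. The consequent
fails at the origin, since nothing on the ray has an edge to `top`. A refuted conclusion always has
a refuted premiss (`Inference.exists_refuted_premiss`), so a refuted root yields an infinite branch,
along which progress of a trace moves its source two edges on.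

On the bare ray such progress could go on forever. By pigeonhole, however, some edge of the ray, at
a position bounded by a constant `K` for the whole preproof, is used by no formula of the current
sequent. Cutting there and bending the remainder into a long genuine segment to `top` keeps the
sequent refuted (`exists_cut_bound`). With a cut after each step, labels on the ray never exceed
`K`, so `Pt.rank` strictly decreases at each progress and never increases. Hence no trace progresses
infinitely often. -/

open Filter

/-! ### Validity of the formula -/

section Validity

variable {V : Vocab} {D : Type*} {M : Struct V D}

/-- Induction from the front of the path. A new block `aa` lengthens the initial `a⁺`; a new block
`aba` moves the splitting point to its own `b`. -/
theorem counterexample_denote {a b : V.Rel} {u w : D}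
    (h : Prog.denote M (.plus (.union (.comp (.atom a) (.atom a))
      (.comp (.atom a) (.comp (.atom b) (.atom a))))) u w) :
    Prog.denote M (.comp (.plus (.atom a))
      (.union (.plus (.comp (.atom b) (.plus (.atom a)))) (.atom a))) u w := by
  simp only [Prog.denote] at h ⊢
  induction h using Relation.TransGen.head_induction_on with
  | single h =>
    rcases h with ⟨x, hx, hy⟩ | ⟨x, hx, y, hy, hz⟩
    · exact ⟨x, .single hx, .inr hy⟩
    · exact ⟨x, .single hx, .inl (.single ⟨y, hy, .single hz⟩)⟩
  | head h _ ih =>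
    obtain ⟨z, hvz, hz⟩ := ih
    rcases h with ⟨x, hx, hy⟩ | ⟨x, hx, y, hy, hv⟩
    · exact ⟨z, .head hx (.head hy hvz), hz⟩
    -- The old `a⁺` prefix now follows the new `b`; if the tail ended in a single `a`, that edge is
    -- absorbed into the same `a⁺`.
    · refine ⟨x, .single hx, .inl ?_⟩
      rcases hz with hz | hz
      · exact .head ⟨y, hy, .head hv hvz⟩ hz
      · exact .single ⟨y, hy, .head hv (hvz.tail hz)⟩

theorem counterexample_valid (a b : V.Rel) (p : V.Pr) :
    PDLFm.Valid.{u} (counterexample a b p) := by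
  intro D M v
  change (∀ w, _ → w ∉ M.pred p) ∨ ∃ w, _ ∧ w ∈ M.pred p
  by_cases h : ∃ w, Prog.denote M (.plus (.union (.comp (.atom a) (.atom a))
      (.comp (.atom a) (.comp (.atom b) (.atom a))))) v w ∧ w ∈ M.pred p
  · obtain ⟨w, hw, hp⟩ := h
    exact .inr ⟨w, counterexample_denote hw, hp⟩
  · exact .inl fun w hw hp => h ⟨w, hw, hp⟩

end Validity

/-! ### Terms and formulas: substitution, constants, action -/

section Substitution

variable {V : Vocab}

theorem Tm.bind_bind {n m k : ℕ} (τ : Fin n → Tm V m) (τ' : Fin m → Tm V k) (t : Tm V n) :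
    (t.bind τ).bind τ' = t.bind fun i => (τ i).bind τ' := by
  induction t with
  | free x => rfl
  | bound i => rfl
  | app f ts ih => simp only [Tm.bind, ih]

@[simp] theorem Tm.up_castSucc {n m : ℕ} (τ : Fin n → Tm V m) (i : Fin n) :
    Tm.up τ i.castSucc = (τ i).lift := by
  simp [Tm.up]

@[simp] theorem Tm.up_last {n m : ℕ} (τ : Fin n → Tm V m) :
    Tm.up τ (Fin.last n) = .bound (Fin.last m) := by
  simp [Tm.up]

@[simp] theorem Tm.lift_bound {n : ℕ} (i : Fin n) :
    (Tm.bound i : Tm V n).lift = .bound i.castSucc := rfl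

theorem Tm.lift_bind_up {n m : ℕ} (τ : Fin n → Tm V m) (t : Tm V n) :
    t.lift.bind (Tm.up τ) = (t.bind τ).lift := by
  simp only [Tm.lift, Tm.bind_bind, Tm.bind, Tm.up_castSucc]

theorem Tm.bind_bound {n : ℕ} (t : Tm V n) : t.bind (fun i => .bound i) = t := by
  induction t with
  | free x => rfl
  | bound i => rfl
  | app f ts ih => simp only [Tm.bind, ih]

theorem Tm.bind_eq_self (τ : Fin 0 → Tm V 0) (t : Tm V 0) : t.bind τ = t := by
  rw [show τ = fun i => .bound i from funext fun i => i.elim0, Tm.bind_bound]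

@[simp] theorem Tm.lift_bind_closed (τ : Fin 1 → Tm V 0) (s : Tm V 0) : s.lift.bind τ = s := by
  rw [Tm.lift, Tm.bind_bind, Tm.bind_eq_self]

@[simp] theorem Tm.hasConst_bind_bound {n m : ℕ} (c : V.Fn 0) (g : Fin n → Fin m) (t : Tm V n) :
    (t.bind fun i => .bound (g i)).HasConst c ↔ t.HasConst c := by
  induction t with
  | free x => rfl
  | bound i => rfl
  | @app k f ts ih =>
    cases k with
    | zero => rfl
    | succ k => exact exists_congr ih

@[simp] theorem Tm.hasConst_lift {n : ℕ} (c : V.Fn 0) (t : Tm V n) :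
    t.lift.HasConst c ↔ t.HasConst c :=
  Tm.hasConst_bind_bound c Fin.castSucc t

theorem Tm.lift_injective {n : ℕ} : Function.Injective (Tm.lift : Tm V n → Tm V (n + 1)) := by
  intro s
  induction s with
  | free x => intro t h; cases t <;> simp_all [Tm.lift, Tm.bind]
  | bound i => intro t h; cases t <;> simp_all [Tm.lift, Tm.bind]
  | app f ts ih =>
    intro t h
    cases t with
    | free x => simp [Tm.lift, Tm.bind] at h
    | bound i => simp [Tm.lift, Tm.bind] at h
    | app g us =>
      simp only [Tm.lift, Tm.bind, Tm.app.injEq] at h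
      obtain ⟨rfl, hf, hts⟩ := h
      obtain rfl := eq_of_heq hf
      congr 1
      funext j
      exact ih j (congrFun (eq_of_heq hts) j)

/-! ### Inverting the action of a substitution -/

variable (σ : Substn V)

theorem Tm.act_eq_bound {n : ℕ} {t : Tm V n} {i : Fin n} (h : t.act σ = .bound i) :
    t = .bound i := by
  cases t with
  | free x => simp [Tm.act] at h
  | bound j => simpa [Tm.act] using h
  | @app k f ts =>
    cases k with
    | zero =>
      simp only [Tm.act] at h
      generalize σ.const f = u at h
      cases u with
      | free x => simp [Tm.bind] at h
      | bound j => exact j.elim0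
      | app g us => simp [Tm.bind] at h
    | succ k => simp [Tm.act] at h

/-- Constants are replaced by closed terms, so the action neither creates nor removes bound
variables: if the image avoids the innermost one, so does the original. -/
theorem Tm.act_eq_lift {n : ℕ} {t : Tm V (n + 1)} {s : Tm V n} (h : t.act σ = s.lift) :
    ∃ s' : Tm V n, t = s'.lift ∧ s'.act σ = s := by
  induction t generalizing s with
  | free x => exact ⟨.free x, rfl, Tm.lift_injective h⟩
  | bound i =>
    cases s with
    | free x => simp [Tm.act, Tm.lift, Tm.bind] at h
    | bound j => exact ⟨.bound j, h, rfl⟩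
    | app g us => simp [Tm.act, Tm.lift, Tm.bind] at h
  | @app k f ts ih =>
    cases k with
    | zero =>
      refine ⟨.app f Fin.elim0, ?_, Tm.lift_injective ?_⟩
      · simp only [Tm.lift, Tm.bind]
        congr 1
        exact funext fun j => j.elim0
      · rw [← h]
        simp only [Tm.act, Tm.lift, Tm.bind_bind]
        congr 1
        exact funext fun j => j.elim0
    | succ k =>
      cases s with
      | free x => simp [Tm.act, Tm.lift, Tm.bind] at h
      | bound j => simp [Tm.act, Tm.lift, Tm.bind] at h
      | app g us =>
        simp only [Tm.act, Tm.lift, Tm.bind, Tm.app.injEq] at h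
        obtain ⟨rfl, hf, hts⟩ := h
        obtain rfl := eq_of_heq hf
        choose s' hs' hs using fun j => ih j (s := us j) (congrFun (eq_of_heq hts) j)
        refine ⟨.app f s', ?_, ?_⟩
        · simp only [Tm.lift, Tm.bind]
          congr 1
          exact funext hs'
        · simp only [Tm.act]
          congr 1
          exact funext hs

variable {σ} {n : ℕ} {A : Fm V n}

theorem Fm.act_eq_pred {p : V.Pr} {t : Tm V n} (h : A.act σ = .pred p t) :
    ∃ t', A = .pred p t' ∧ t'.act σ = t := by
  cases A <;> simp_all [Fm.act]

theorem Fm.act_eq_npred {p : V.Pr} {t : Tm V n} (h : A.act σ = .npred p t) :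
    ∃ t', A = .npred p t' ∧ t'.act σ = t := by
  cases A <;> simp_all [Fm.act]

theorem Fm.act_eq_rel {a : V.Rel} {s t : Tm V n} (h : A.act σ = .rel a s t) :
    ∃ s' t', A = .rel a s' t' ∧ s'.act σ = s ∧ t'.act σ = t := by
  cases A <;> simp_all [Fm.act]

theorem Fm.act_eq_nrel {a : V.Rel} {s t : Tm V n} (h : A.act σ = .nrel a s t) :
    ∃ s' t', A = .nrel a s' t' ∧ s'.act σ = s ∧ t'.act σ = t := by
  cases A <;> simp_all [Fm.act]

theorem Fm.act_eq_and {B C : Fm V n} (h : A.act σ = .and B C) :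
    ∃ B' C', A = .and B' C' ∧ B'.act σ = B ∧ C'.act σ = C := by
  cases A <;> simp_all [Fm.act]

theorem Fm.act_eq_or {B C : Fm V n} (h : A.act σ = .or B C) :
    ∃ B' C', A = .or B' C' ∧ B'.act σ = B ∧ C'.act σ = C := by
  cases A <;> simp_all [Fm.act]

theorem Fm.act_eq_all {B : Fm V (n + 1)} (h : A.act σ = .all B) :
    ∃ B', A = .all B' ∧ B'.act σ = B := by
  cases A <;> simp_all [Fm.act]

theorem Fm.act_eq_ex {B : Fm V (n + 1)} (h : A.act σ = .ex B) :
    ∃ B', A = .ex B' ∧ B'.act σ = B := by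
  cases A <;> simp_all [Fm.act]

theorem Fm.act_eq_tc {B : Fm V (n + 2)} {s t : Tm V n} (h : A.act σ = .tc B s t) :
    ∃ B' s' t', A = .tc B' s' t' ∧ B'.act σ = B ∧ s'.act σ = s ∧ t'.act σ = t := by
  cases A <;> simp_all [Fm.act]

theorem Fm.act_eq_cotc {B : Fm V (n + 2)} {s t : Tm V n} (h : A.act σ = .cotc B s t) :
    ∃ B' s' t', A = .cotc B' s' t' ∧ B'.act σ = B ∧ s'.act σ = s ∧ t'.act σ = t := by
  cases A <;> simp_all [Fm.act]

end Substitution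

/-! ### The structure of labels -/

/-- Labels: an infinite ray, finite segments of every length leading to `top`, and `top`. -/
inductive Pt : Type
  | ray (n : ℕ)
  | seg (i j : ℕ)
  | top

namespace Pt

/-- The edges; `seg i j` is at distance `j + 1` from `top`. -/
def Edge : Pt → Pt → Prop
  | ray n, ray k => k = n + 1
  | seg i j, seg i' j' => i = i' ∧ j = j' + 1
  | seg _ j, top => j = 0
  | _, _ => False

/-- Reachability, where `top` is regarded as reachable from the ray. -/
def Path : Pt → Pt → Prop
  | ray n, ray k => n < k
  | ray _, top => True
  | seg i j, seg i' j' => i = i' ∧ j' < j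
  | seg _ _, top => True
  | _, _ => False

/-- The points regarded as having an even distance to `top`. -/
def Good : Pt → Prop
  | ray n => Even n
  | seg _ j => Odd j
  | top => False

/-- Two edges further along. -/
def Advance : Pt → Pt → Prop
  | ray n, ray k => k = n + 2
  | seg i j, seg i' j' => i = i' ∧ j = j' + 2
  | _, _ => False

/-- Cut the ray after `m` and turn its remainder into a segment. -/
def cut (m q : ℕ) : Pt → Pt
  | ray n => if n ≤ m then ray n else seg q (2 * q + 1 - n)
  | d => d

theorem Edge.path {d e : Pt} (h : Edge d e) : Path d e := by
  cases d <;> cases e <;> simp_all [Edge, Path]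

theorem Path.head {d e f : Pt} (h : Edge d e) (h' : Path e f) : Path d f := by
  cases d <;> cases e <;> cases f <;> simp_all [Edge, Path] <;> omega

/-- The only edge of the ray that a cut after `m` destroys is the one from `ray m` to `ray (m + 1)`.
For large `q` the truncated subtraction in `cut` is exact, so later edges become edges of the
segment. -/
theorem Edge.eventually_cut {d e : Pt} (h : Edge d e) :
    ∃ x, ∀ m, m ≠ x → ∀ᶠ q in atTop, Edge (cut m q d) (cut m q e) := by
  cases d with
  | top => cases e <;> simp [Edge] at h
  | seg i j => cases e <;> simp_all [Edge, cut]
  | ray n =>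
    cases e with
    | top => simp [Edge] at h
    | seg i j => simp [Edge] at h
    | ray k =>
      simp only [Edge] at h
      subst h
      refine ⟨n, fun m hm => ?_⟩
      filter_upwards [eventually_ge_atTop (n + 1)] with q hq
      simp only [cut]
      split_ifs <;> simp only [Edge, true_and] <;> omega

/-- No edge is created once `q` is large: the segment is then different from those already in use,
and the two points are far from `top`. -/
theorem eventually_not_edge_cut {d e : Pt} (h : ¬ Edge d e) (m : ℕ) :
    ∀ᶠ q in atTop, ¬ Edge (cut m q d) (cut m q e) := by
  cases d with
  | top => cases e <;> simp_all [Edge, cut]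
  | seg i j =>
    filter_upwards [eventually_gt_atTop i] with q hq
    cases e <;> simp_all [Edge, cut]
    split_ifs
    · simp only [not_false_eq_true]
    · omega
  | ray n =>
    cases e with
    | top =>
      filter_upwards [eventually_ge_atTop n] with q hq
      simp only [cut]
      split_ifs
      · simp only [Edge, not_false_eq_true]
      · simp only [Edge]
        omega
    | seg i j =>
      filter_upwards [eventually_gt_atTop i] with q hq
      simp only [cut]
      split_ifs
      · simp only [Edge, not_false_eq_true]
      · simp only [Edge]
        omega
    | ray k =>
      filter_upwards [eventually_ge_atTop (n + k)] with q hq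
      simp only [Edge] at h
      simp only [cut]
      split_ifs <;> simp only [Edge, not_false_eq_true, true_and] <;> omega

/-- A cut moves later points of the ray to a segment that does reach `top`; the convention that the
ray reaches `top` is what makes non-reachability survive. -/
theorem eventually_not_path_cut {d e : Pt} (h : ¬ Path d e) (m : ℕ) :
    ∀ᶠ q in atTop, ¬ Path (cut m q d) (cut m q e) := by
  cases d with
  | top => cases e <;> simp_all [Path, cut]
  | seg i j =>
    filter_upwards [eventually_gt_atTop i] with q hq
    cases e <;> simp_all [Path, cut]
    split_ifs
    · simp only [not_false_eq_true]
    · omega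
  | ray n =>
    cases e with
    | top => simp [Path] at h
    | seg i j =>
      filter_upwards [eventually_gt_atTop i] with q hq
      simp only [cut]
      split_ifs
      · simp only [Path, not_false_eq_true]
      · simp only [Path]
        omega
    | ray k =>
      filter_upwards [eventually_ge_atTop (n + k)] with q hq
      simp only [Path] at h
      simp only [cut]
      split_ifs <;> simp only [Path, not_false_eq_true, true_and] <;> omega

/-- The odd constant in `2 * q + 1 - n` turns even positions on the ray into odd indices, that is,
into even distances from `top`. -/
theorem Good.eventually_cut {d : Pt} (h : Good d) (m : ℕ) :
    ∀ᶠ q in atTop, Good (cut m q d) := by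
  cases d with
  | top => simp [Good] at h
  | seg i j => exact .of_forall fun _ => h
  | ray n =>
    filter_upwards [eventually_ge_atTop n] with q hq
    simp only [Good] at h
    simp only [cut]
    split_ifs
    · exact h
    · simp only [Good]
      obtain ⟨k, rfl⟩ := h
      exact ⟨q - k, by omega⟩

/-- Only `seg i 1` is exactly two edges from `top`. Every other good point, in particular every one
on the ray, has a good point two edges further on. -/
theorem Good.advance {d : Pt} (h : Good d) :
    (∃ e, Edge d e ∧ Edge e top) ∨ ∃ e f, Edge d e ∧ Edge e f ∧ Advance d f ∧ Good f := by
  cases d with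
  | top => simp [Good] at h
  | ray n =>
    refine .inr ⟨ray (n + 1), ray (n + 2), rfl, rfl, rfl, ?_⟩
    simp only [Good] at h ⊢
    exact h.add (by decide)
  | seg i j =>
    simp only [Good] at h
    obtain ⟨k, rfl⟩ := h
    cases k with
    | zero => exact .inl ⟨seg i 0, ⟨rfl, rfl⟩, rfl⟩
    | succ k =>
      refine .inr ⟨seg i (2 * k + 2), seg i (2 * k + 1), ⟨rfl, by ring⟩, ⟨rfl, by ring⟩,
        ⟨rfl, by ring⟩, ⟨k, rfl⟩⟩

/-- A rank that decreases with each advance, for labels on the ray not exceeding `K`. -/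
def rank (K : ℕ) : Pt → ℕ ×ₗ ℕ
  | ray n => toLex (1, K + 2 - n)
  | seg _ j => toLex (0, j)
  | top => toLex (0, 0)

theorem rank_cut_le (K m q : ℕ) (d : Pt) : rank K (cut m q d) ≤ rank K d := by
  cases d with
  | top => exact le_rfl
  | seg i j => exact le_rfl
  | ray n =>
    simp only [cut]
    split_ifs
    · exact le_rfl
    · exact (Prod.Lex.left _ _ Nat.zero_lt_one : toLex (0, _) < toLex (1, _)).le

theorem Advance.rank_lt {K : ℕ} {d e : Pt} (h : Advance d e) (hd : ∀ n, d = ray n → n ≤ K) :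
    rank K e < rank K d := by
  cases d with
  | top => cases e <;> simp [Advance] at h
  | seg i j =>
    cases e <;> simp [Advance] at h
    simp only [rank, h]
    exact Prod.Lex.right _ (by omega)
  | ray n =>
    cases e <;> simp [Advance] at h
    simp only [rank, h]
    have := hd n rfl
    exact Prod.Lex.right _ (by omega)

theorem cut_eq_ray {m q n : ℕ} {d : Pt} (h : cut m q d = ray n) : n ≤ m := by
  cases d with
  | top => simp [cut] at h
  | seg i j => simp [cut] at h
  | ray k =>
    simp only [cut] at h
    split_ifs at h with hk
    · cases h; exact hk

end Pt

/-! ### Refuted formulas -/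

section Refuted

variable {V : Vocab}

/-- The body `λ x y. a(x, y)`. -/
def edgeBody (a : V.Rel) (n : ℕ) : Fm V (n + 2) :=
  .rel a (.bound (Fin.last n).castSucc) (.bound (Fin.last (n + 1)))

/-- The body `λ x y. ∀ z (¬ a(x, z) ∨ ¬ a(z, y))`. -/
def twoBody (a : V.Rel) (n : ℕ) : Fm V (n + 2) :=
  .all (.or (.nrel a (.bound (Fin.last n).castSucc.castSucc) (.bound (Fin.last (n + 2))))
    (.nrel a (.bound (Fin.last (n + 2))) (.bound (Fin.last (n + 1)).castSucc)))

theorem edgeBody_bind (a : V.Rel) {n m : ℕ} (τ : Fin n → Tm V m) :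
    (edgeBody a n).bind (Tm.up (Tm.up τ)) = edgeBody a m := by
  simp [edgeBody, Fm.bind, Tm.bind]

theorem twoBody_bind (a : V.Rel) {n m : ℕ} (τ : Fin n → Tm V m) :
    (twoBody a n).bind (Tm.up (Tm.up τ)) = twoBody a m := by
  simp [twoBody, Fm.bind, Tm.bind]

theorem twoBody_inst₂ (a : V.Rel) (s t : Tm V 0) :
    (twoBody a 0).inst₂ s t = .all (.or (.nrel a s.lift (.bound (Fin.last 0)))
      (.nrel a (.bound (Fin.last 0)) t.lift)) := by
  simp only [twoBody, Fm.inst₂, Fm.bind, Tm.bind, Tm.up_castSucc, Tm.up_last]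
  rfl

theorem eq_edgeBody_of_act {a : V.Rel} {n : ℕ} {σ : Substn V} {A : Fm V (n + 2)}
    (h : A.act σ = edgeBody a n) : A = edgeBody a n := by
  obtain ⟨s, t, rfl, hs, ht⟩ := Fm.act_eq_rel h
  rw [Tm.act_eq_bound σ hs, Tm.act_eq_bound σ ht, edgeBody]

theorem eq_twoBody_of_act {a : V.Rel} {n : ℕ} {σ : Substn V} {A : Fm V (n + 2)}
    (h : A.act σ = twoBody a n) : A = twoBody a n := by
  obtain ⟨B, rfl, h₁⟩ := Fm.act_eq_all h
  obtain ⟨B, C, rfl, hB, hC⟩ := Fm.act_eq_or h₁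
  obtain ⟨s, t, rfl, hs, ht⟩ := Fm.act_eq_nrel hB
  obtain ⟨s', t', rfl, hs', ht'⟩ := Fm.act_eq_nrel hC
  rw [Tm.act_eq_bound σ hs, Tm.act_eq_bound σ ht, Tm.act_eq_bound σ hs', Tm.act_eq_bound σ ht',
    twoBody]

/-- Formulas refuted by a labelling of the closed terms.  The formulas `¬ b(s, t)` do not occur,
and the dual transitive closure formulas are read nonstandardly on the ray. -/
inductive Refuted (a b : V.Rel) (p : V.Pr) (ρ : Tm V 0 → Pt) : Fm V 0 → Prop
  | or {A B : Fm V 0} : Refuted a b p ρ A → Refuted a b p ρ B → Refuted a b p ρ (.or A B)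
  | and_left {A B : Fm V 0} : Refuted a b p ρ A → Refuted a b p ρ (.and A B)
  | and_right {A B : Fm V 0} : Refuted a b p ρ B → Refuted a b p ρ (.and A B)
  | pred {t : Tm V 0} : ρ t ≠ .top → Refuted a b p ρ (.pred p t)
  | npred {t : Tm V 0} : ρ t = .top → Refuted a b p ρ (.npred p t)
  | rel {s t : Tm V 0} : ¬ (ρ s).Edge (ρ t) → Refuted a b p ρ (.rel a s t)
  | rel_empty {s t : Tm V 0} : Refuted a b p ρ (.rel b s t)
  | nrel {s t : Tm V 0} : (ρ s).Edge (ρ t) → Refuted a b p ρ (.nrel a s t)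
  | tc {s t : Tm V 0} : ¬ (ρ s).Path (ρ t) → Refuted a b p ρ (.tc (edgeBody a 0) s t)
  | tc_empty {u v : Tm V 3} {Q : Fm V 3} {s t : Tm V 0} :
      Refuted a b p ρ (.tc (.ex (.and (.rel b u v) Q)) s t)
  | ex_empty {u v : Tm V 1} {Q : Fm V 1} : Refuted a b p ρ (.ex (.and (.rel b u v) Q))
  | ex_path {s : Tm V 0} {u v : Tm V 5} {Q : Fm V 5} {u' v' : Tm V 2} : ρ s = .ray 0 →
      Refuted a b p ρ (.ex (.and
        (.ex (.and (.tc (edgeBody a 2) s.lift.lift (.bound (Fin.last 1)))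
          (.or (.tc (.ex (.and (.rel b u v) Q)) u' v')
            (.rel a (.bound (Fin.last 1)) (.bound (Fin.last 0).castSucc)))))
        (.pred p (.bound (Fin.last 0)))))
  | ex_path_to {s t : Tm V 0} {u v : Tm V 4} {Q : Fm V 4} {u' v' : Tm V 1} : ρ s = .ray 0 →
      ρ t = .top →
      Refuted a b p ρ (.ex (.and (.tc (edgeBody a 1) s.lift (.bound (Fin.last 0)))
        (.or (.tc (.ex (.and (.rel b u v) Q)) u' v') (.rel a (.bound (Fin.last 0)) t.lift))))
  | all_two {s t : Tm V 0} {d : Pt} : (ρ s).Edge d → d.Edge (ρ t) →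
      Refuted a b p ρ (.all (.or (.nrel a s.lift (.bound (Fin.last 0)))
        (.nrel a (.bound (Fin.last 0)) t.lift)))
  | all_cotc {s : Tm V 0} {Z : Fm V 3} : ρ s = .ray 0 →
      Refuted a b p ρ (.all (.or (.cotc (.and (twoBody a 1) Z) s.lift (.bound (Fin.last 0)))
        (.npred p (.bound (Fin.last 0)))))
  | cotc {s t : Tm V 0} {Z : Fm V 2} : (ρ s).Good → ρ t = .top →
      Refuted a b p ρ (.cotc (.and (twoBody a 0) Z) s t)

namespace Refuted

/-! ### Stability of refutation under relabelling and substitution -/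

variable {a b : V.Rel} {p : V.Pr} {ρ ρ' : Tm V 0 → Pt} {A : Fm V 0}

theorem of_fresh (h : Refuted a b p ρ A) {c : V.Fn 0} (hc : ¬ A.HasConst c)
    (hρ : ∀ t : Tm V 0, ¬ t.HasConst c → ρ' t = ρ t) : Refuted a b p ρ' A := by
  induction h with
  | or _ _ ih ih' => exact .or (ih fun h => hc (.inl h)) (ih' fun h => hc (.inr h))
  | and_left _ ih => exact .and_left (ih fun h => hc (.inl h))
  | and_right _ ih => exact .and_right (ih fun h => hc (.inr h))
  | pred h => exact .pred (by rwa [hρ _ hc])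
  | npred h => exact .npred (by rwa [hρ _ hc])
  | rel h => exact .rel (by rwa [hρ _ fun h => hc (.inl h), hρ _ fun h => hc (.inr h)])
  | rel_empty => exact .rel_empty
  | nrel h => exact .nrel (by rwa [hρ _ fun h => hc (.inl h), hρ _ fun h => hc (.inr h)])
  | tc h =>
    exact .tc (by rwa [hρ _ fun h => hc (.inr (.inl h)), hρ _ fun h => hc (.inr (.inr h))])
  | tc_empty => exact .tc_empty
  | ex_empty => exact .ex_empty
  | ex_path h => exact .ex_path (by rwa [hρ]; simp_all [Fm.HasConst])
  | ex_path_to h h' =>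
    exact .ex_path_to (by rwa [hρ]; simp_all [Fm.HasConst]) (by rwa [hρ]; simp_all [Fm.HasConst])
  | all_two h h' =>
    exact .all_two (by rwa [hρ]; simp_all [Fm.HasConst]) (by rwa [hρ]; simp_all [Fm.HasConst])
  | all_cotc h => exact .all_cotc (by rwa [hρ]; simp_all [Fm.HasConst])
  | cotc h h' =>
    exact .cotc (by rwa [hρ _ fun h => hc (.inr (.inl h))]) (by rwa [hρ _ fun h => hc (.inr (.inr h))])

/-- The shape of each refuted formula can be read back through the action. Subformulas irrelevant to
the refutation are left arbitrary in `Refuted`, so nothing need be known about their preimages. -/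
theorem of_act {σ : Substn V} (h : Refuted a b p ρ (A.act σ)) :
    Refuted a b p (fun t => ρ (t.act σ)) A := by
  generalize hB : A.act σ = B at h
  induction h generalizing A with
  | or _ _ ih ih' =>
    obtain ⟨C, D, rfl, hC, hD⟩ := Fm.act_eq_or hB
    exact .or (ih hC) (ih' hD)
  | and_left _ ih =>
    obtain ⟨C, D, rfl, hC, hD⟩ := Fm.act_eq_and hB
    exact .and_left (ih hC)
  | and_right _ ih =>
    obtain ⟨C, D, rfl, hC, hD⟩ := Fm.act_eq_and hB
    exact .and_right (ih hD)
  | pred h =>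
    obtain ⟨t, rfl, rfl⟩ := Fm.act_eq_pred hB
    exact .pred h
  | npred h =>
    obtain ⟨t, rfl, rfl⟩ := Fm.act_eq_npred hB
    exact .npred h
  | rel h =>
    obtain ⟨s, t, rfl, rfl, rfl⟩ := Fm.act_eq_rel hB
    exact .rel h
  | rel_empty =>
    obtain ⟨s, t, rfl, rfl, rfl⟩ := Fm.act_eq_rel hB
    exact .rel_empty
  | nrel h =>
    obtain ⟨s, t, rfl, rfl, rfl⟩ := Fm.act_eq_nrel hB
    exact .nrel h
  | tc h =>
    obtain ⟨C, s, t, rfl, hC, rfl, rfl⟩ := Fm.act_eq_tc hB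
    rw [eq_edgeBody_of_act hC]
    exact .tc h
  | tc_empty =>
    obtain ⟨C, s, t, rfl, hC, rfl, rfl⟩ := Fm.act_eq_tc hB
    obtain ⟨C, rfl, hC₁⟩ := Fm.act_eq_ex hC
    obtain ⟨C, D, rfl, hC₂, -⟩ := Fm.act_eq_and hC₁
    obtain ⟨s, t, rfl, -, -⟩ := Fm.act_eq_rel hC₂
    exact .tc_empty
  | ex_empty =>
    obtain ⟨C, rfl, hC⟩ := Fm.act_eq_ex hB
    obtain ⟨C, D, rfl, hC₁, -⟩ := Fm.act_eq_and hC
    obtain ⟨s, t, rfl, -, -⟩ := Fm.act_eq_rel hC₁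
    exact .ex_empty
  | ex_path h =>
    obtain ⟨C, rfl, hC⟩ := Fm.act_eq_ex hB
    obtain ⟨C, D, rfl, hC₁, hD⟩ := Fm.act_eq_and hC
    obtain ⟨x, rfl, hx⟩ := Fm.act_eq_pred hD
    obtain ⟨C, rfl, hC₂⟩ := Fm.act_eq_ex hC₁
    obtain ⟨C, D, rfl, hC₃, hD⟩ := Fm.act_eq_and hC₂
    obtain ⟨C, s, t, rfl, hC₄, hs, ht⟩ := Fm.act_eq_tc hC₃
    obtain ⟨D, E, rfl, hD₁, hE⟩ := Fm.act_eq_or hD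
    obtain ⟨D, s', t', rfl, hD₂, -, -⟩ := Fm.act_eq_tc hD₁
    obtain ⟨D, rfl, hD₃⟩ := Fm.act_eq_ex hD₂
    obtain ⟨D, Q, rfl, hD₄, -⟩ := Fm.act_eq_and hD₃
    obtain ⟨u, v, rfl, -, -⟩ := Fm.act_eq_rel hD₄
    obtain ⟨y, z, rfl, hy, hz⟩ := Fm.act_eq_rel hE
    obtain ⟨s, rfl, hs₁⟩ := Tm.act_eq_lift σ hs
    obtain ⟨s, rfl, rfl⟩ := Tm.act_eq_lift σ hs₁
    rw [Tm.act_eq_bound σ hx, Tm.act_eq_bound σ ht, Tm.act_eq_bound σ hy, Tm.act_eq_bound σ hz,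
      eq_edgeBody_of_act hC₄]
    exact .ex_path h
  | ex_path_to h h' =>
    obtain ⟨C, rfl, hC⟩ := Fm.act_eq_ex hB
    obtain ⟨C, D, rfl, hC₁, hD⟩ := Fm.act_eq_and hC
    obtain ⟨C, s, t, rfl, hC₂, hs, ht⟩ := Fm.act_eq_tc hC₁
    obtain ⟨D, E, rfl, hD₁, hE⟩ := Fm.act_eq_or hD
    obtain ⟨D, s', t', rfl, hD₂, -, -⟩ := Fm.act_eq_tc hD₁
    obtain ⟨D, rfl, hD₃⟩ := Fm.act_eq_ex hD₂
    obtain ⟨D, Q, rfl, hD₄, -⟩ := Fm.act_eq_and hD₃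
    obtain ⟨u, v, rfl, -, -⟩ := Fm.act_eq_rel hD₄
    obtain ⟨y, z, rfl, hy, hz⟩ := Fm.act_eq_rel hE
    obtain ⟨s, rfl, rfl⟩ := Tm.act_eq_lift σ hs
    obtain ⟨z, rfl, rfl⟩ := Tm.act_eq_lift σ hz
    rw [Tm.act_eq_bound σ ht, Tm.act_eq_bound σ hy, eq_edgeBody_of_act hC₂]
    exact .ex_path_to h h'
  | all_two h h' =>
    obtain ⟨C, rfl, hC⟩ := Fm.act_eq_all hB
    obtain ⟨C, D, rfl, hC₁, hD⟩ := Fm.act_eq_or hC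
    obtain ⟨s, t, rfl, hs, ht⟩ := Fm.act_eq_nrel hC₁
    obtain ⟨s', t', rfl, hs', ht'⟩ := Fm.act_eq_nrel hD
    obtain ⟨s, rfl, rfl⟩ := Tm.act_eq_lift σ hs
    obtain ⟨t', rfl, rfl⟩ := Tm.act_eq_lift σ ht'
    rw [Tm.act_eq_bound σ ht, Tm.act_eq_bound σ hs']
    exact .all_two h h'
  | all_cotc h =>
    obtain ⟨C, rfl, hC⟩ := Fm.act_eq_all hB
    obtain ⟨C, D, rfl, hC₁, hD⟩ := Fm.act_eq_or hC
    obtain ⟨C, s, t, rfl, hC₂, hs, ht⟩ := Fm.act_eq_cotc hC₁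
    obtain ⟨C, Z, rfl, hC₃, -⟩ := Fm.act_eq_and hC₂
    obtain ⟨x, rfl, hx⟩ := Fm.act_eq_npred hD
    obtain ⟨s, rfl, rfl⟩ := Tm.act_eq_lift σ hs
    rw [Tm.act_eq_bound σ ht, Tm.act_eq_bound σ hx, eq_twoBody_of_act hC₃]
    exact .all_cotc h
  | cotc h h' =>
    obtain ⟨C, s, t, rfl, hC, rfl, rfl⟩ := Fm.act_eq_cotc hB
    obtain ⟨C, Z, rfl, hC₁, -⟩ := Fm.act_eq_and hC
    rw [eq_twoBody_of_act hC₁]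
    exact .cotc h h'

end Refuted

/-- A bound on the number of edges of the ray that a refutation of the formula relies on. -/
def Fm.weight {n : ℕ} : Fm V n → ℕ
  | .or A B => A.weight + B.weight
  | .and A B => A.weight + B.weight
  | _ => 2

/-- Only `nrel` and `all_two` rely on the presence of edges, one and two respectively; `U` collects
their positions on the ray. The other clauses rely on absence of edges or paths, on parity, or on
the labels `ray 0` and `top`, which no cut moves. -/
theorem Refuted.exists_finset_cut {a b : V.Rel} {p : V.Pr} {ρ : Tm V 0 → Pt} {A : Fm V 0}
    (h : Refuted a b p ρ A) : ∃ U : Finset ℕ, U.card ≤ A.weight ∧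
      ∀ m ∉ U, ∀ᶠ q in atTop, Refuted a b p (fun t => (ρ t).cut m q) A := by
  induction h with
  | or _ _ ih ih' =>
    obtain ⟨U, hU, h⟩ := ih
    obtain ⟨U', hU', h'⟩ := ih'
    refine ⟨U ∪ U', (Finset.card_union_le _ _).trans (add_le_add hU hU'), fun m hm => ?_⟩
    simp only [Finset.mem_union, not_or] at hm
    filter_upwards [h m hm.1, h' m hm.2] with q using .or
  | and_left _ ih =>
    obtain ⟨U, hU, h⟩ := ih
    exact ⟨U, hU.trans (Nat.le_add_right _ _), fun m hm => (h m hm).mono fun _ => .and_left⟩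
  | and_right _ ih =>
    obtain ⟨U, hU, h⟩ := ih
    exact ⟨U, hU.trans (Nat.le_add_left _ _), fun m hm => (h m hm).mono fun _ => .and_right⟩
  | @pred t h =>
    refine ⟨∅, by simp, fun m _ => .of_forall fun q => .pred ?_⟩
    cases hd : ρ t <;> simp_all [Pt.cut]
    split_ifs <;> simp
  | npred h => exact ⟨∅, by simp, fun m _ => .of_forall fun q => .npred (by simp [h, Pt.cut])⟩
  | rel h => exact ⟨∅, by simp, fun m _ => (Pt.eventually_not_edge_cut h m).mono fun _ hq => .rel hq⟩
  | rel_empty => exact ⟨∅, by simp, fun m _ => .of_forall fun q => .rel_empty⟩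
  | nrel h =>
    obtain ⟨x, hx⟩ := h.eventually_cut
    exact ⟨{x}, by simp [Fm.weight], fun m hm => (hx m (by simpa using hm)).mono
      fun _ hq => .nrel hq⟩
  | tc h => exact ⟨∅, by simp, fun m _ => (Pt.eventually_not_path_cut h m).mono fun _ hq => .tc hq⟩
  | tc_empty => exact ⟨∅, by simp, fun m _ => .of_forall fun q => .tc_empty⟩
  | ex_empty => exact ⟨∅, by simp, fun m _ => .of_forall fun q => .ex_empty⟩
  | ex_path h => exact ⟨∅, by simp, fun m _ => .of_forall fun q => .ex_path (by simp [h, Pt.cut])⟩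
  | ex_path_to h h' =>
    exact ⟨∅, by simp, fun m _ => .of_forall fun q =>
      .ex_path_to (by simp [h, Pt.cut]) (by simp [h', Pt.cut])⟩
  | all_two h h' =>
    obtain ⟨x, hx⟩ := h.eventually_cut
    obtain ⟨y, hy⟩ := h'.eventually_cut
    refine ⟨{x, y}, Finset.card_le_two, fun m hm => ?_⟩
    simp only [Finset.mem_insert, Finset.mem_singleton, not_or] at hm
    filter_upwards [hx m hm.1, hy m hm.2] with q hq hq' using .all_two hq hq'
  | all_cotc h =>
    exact ⟨∅, by simp, fun m _ => .of_forall fun q => .all_cotc (by simp [h, Pt.cut])⟩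
  | cotc h h' =>
    exact ⟨∅, by simp, fun m _ => (h.eventually_cut m).mono fun q hq =>
      .cotc hq (by simp [h', Pt.cut])⟩

/-- Pigeonhole: at most `K` positions are forbidden, so one of `0, …, K` is free. The bound depends
on the sequent but not on the labelling. -/
theorem exists_cut_bound (a b : V.Rel) (p : V.Pr) {Γ : Set (Fm V 0)} (hΓ : Γ.Finite) :
    ∃ K, ∀ ρ : Tm V 0 → Pt, (∀ A ∈ Γ, Refuted a b p ρ A) →
      ∃ m ≤ K, ∃ q, ∀ A ∈ Γ, Refuted a b p (fun t => (ρ t).cut m q) A := by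
  classical
  refine ⟨∑ A ∈ hΓ.toFinset, A.weight, fun ρ hρ => ?_⟩
  choose! U hU hcut using fun A hA => (hρ A hA).exists_finset_cut
  have hcard : (hΓ.toFinset.biUnion U).card <
      (Finset.range (∑ A ∈ hΓ.toFinset, A.weight + 1)).card := by
    rw [Finset.card_range, Nat.lt_succ_iff]
    exact Finset.card_biUnion_le.trans
      (Finset.sum_le_sum fun A hA => hU A (hΓ.mem_toFinset.1 hA))
  obtain ⟨m, hm, hmU⟩ := Finset.exists_mem_notMem_of_card_lt_card hcard
  simp only [Finset.mem_biUnion, Set.Finite.mem_toFinset, not_exists, not_and] at hmU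
  refine ⟨m, Nat.lt_succ_iff.1 (Finset.mem_range.1 hm), ?_⟩
  exact (((eventually_all_finite hΓ).2 fun A hA => hcut A hA m (hmU A hA)).exists)

end Refuted

/-! ### Refuted sequents propagate upwards -/

section Propagation

variable {V : Vocab}

open Classical in
/-- Give the label `d` to all terms in which `c` occurs. -/
noncomputable def relabel (ρ : Tm V 0 → Pt) (c : V.Fn 0) (d : Pt) : Tm V 0 → Pt :=
  fun t => if t.HasConst c then d else ρ t

theorem relabel_const (ρ : Tm V 0 → Pt) (c : V.Fn 0) (d : Pt) : relabel ρ c d (.const c) = d :=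
  if_pos rfl

theorem relabel_of_not {ρ : Tm V 0 → Pt} {c : V.Fn 0} {d : Pt} {t : Tm V 0}
    (h : ¬ t.HasConst c) : relabel ρ c d t = ρ t :=
  if_neg h

variable {a b : V.Rel} {p : V.Pr} {ρ : Tm V 0 → Pt}

theorem Refuted.relabel {A : Fm V 0} (h : Refuted a b p ρ A) {c : V.Fn 0} (hc : ¬ A.HasConst c)
    (d : Pt) : Refuted a b p (relabel ρ c d) A :=
  h.of_fresh hc fun _ => relabel_of_not

theorem Refuted.ex_inst {A : Fm V 1} (h : Refuted a b p ρ (.ex A)) (u : Tm V 0) :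
    Refuted a b p ρ (A.inst u) := by
  cases h with
  | ex_empty => exact .and_left .rel_empty
  | @ex_path s _ _ _ _ _ hs =>
    simp only [Fm.inst, Fm.bind, Tm.bind, Tm.lift_bind_up, Tm.lift_bind_closed, edgeBody_bind,
      Tm.up_last, Tm.up_castSucc]
    by_cases hu : ρ u = .top
    · exact .and_left (.ex_path_to hs hu)
    · exact .and_right (.pred hu)
  | @ex_path_to s t _ _ _ _ _ hs ht =>
    simp only [Fm.inst, Fm.bind, Tm.bind, Tm.lift_bind_closed, edgeBody_bind]
    -- A point reachable from `ray 0` is on the ray or is `top`, and neither kind has an edge to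
    -- `top`.
    by_cases hu : (ρ s).Path (ρ u)
    · refine .and_right (.or .tc_empty (.rel ?_))
      rw [ht]
      rw [hs] at hu
      cases hd : ρ u <;> simp_all [Pt.Path, Pt.Edge]
    · exact .and_left (.tc hu)

theorem Refuted.all_inst {A : Fm V 1} (h : Refuted a b p ρ (.all A)) {c : V.Fn 0}
    (hc : ¬ (Fm.all A).HasConst c) :
    ∃ d, Refuted a b p (_root_.relabel ρ c d) (A.inst (.const c)) := by
  cases h with
  | @all_two s t d hs ht =>
    refine ⟨d, ?_⟩
    simp only [Fm.inst, Fm.bind, Tm.bind, Tm.lift_bind_closed]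
    simp only [Fm.HasConst, Tm.hasConst_lift, Tm.HasConst, not_or] at hc
    refine .or (.nrel ?_) (.nrel ?_)
    · rwa [relabel_const, relabel_of_not hc.1.1]
    · rwa [relabel_const, relabel_of_not hc.2.2]
  | @all_cotc s Z hs =>
    refine ⟨.top, ?_⟩
    simp only [Fm.inst, Fm.bind, Tm.bind, Tm.lift_bind_closed, twoBody_bind]
    simp only [Fm.HasConst, Tm.hasConst_lift, Tm.HasConst, not_or] at hc
    refine .or (.cotc ?_ (relabel_const _ _ _)) (.npred (relabel_const _ _ _))
    rw [relabel_of_not hc.1.2.1, hs]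
    exact Even.zero

theorem Refuted.tc_inst₂ {A : Fm V 2} {s t : Tm V 0} (h : Refuted a b p ρ (.tc A s t)) :
    Refuted a b p ρ (A.inst₂ s t) := by
  cases h with
  | tc h => exact .rel fun h' => h h'.path
  | tc_empty => exact .ex_empty

theorem Refuted.tc_step {A : Fm V 2} {s t : Tm V 0} (h : Refuted a b p ρ (.tc A s t))
    (u : Tm V 0) : Refuted a b p ρ (A.inst₂ s u) ∨ Refuted a b p ρ (.tc A u t) := by
  cases h with
  | tc h =>
    by_cases hu : (ρ s).Edge (ρ u)
    · exact .inr (.tc fun h' => h (.head hu h'))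
    · exact .inl (.rel hu)
  | tc_empty => exact .inr .tc_empty

/-- Always follow the block `aa`, never `aba`; this is why negated `b`-atoms never have to be
refuted. If `t` is exactly two edges away the left premiss is refuted, otherwise the eigenvariable
is placed two edges further on. -/
theorem Refuted.cotc_step {A : Fm V 2} {s t : Tm V 0} (h : Refuted a b p ρ (.cotc A s t))
    {c : V.Fn 0} (hc : ¬ (Fm.cotc A s t).HasConst c) :
    Refuted a b p ρ (A.inst₂ s t) ∨
      ∃ d, (ρ s).Advance d ∧ Refuted a b p (_root_.relabel ρ c d) (A.inst₂ s (.const c)) ∧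
        Refuted a b p (_root_.relabel ρ c d) (.cotc A (.const c) t) := by
  cases h with
  | @cotc _ _ Z hs ht =>
    simp only [Fm.HasConst, not_or] at hc
    rcases hs.advance with ⟨e, he, he'⟩ | ⟨e, f, he, hf, hadv, hgood⟩
    · left
      refine .and_left ?_
      change Refuted a b p ρ ((twoBody a 0).inst₂ s t)
      rw [twoBody_inst₂]
      exact .all_two he (by rwa [ht])
    · refine .inr ⟨f, hadv, .and_left ?_, .cotc ?_ ?_⟩
      · change Refuted a b p _ ((twoBody a 0).inst₂ s (.const c))
        rw [twoBody_inst₂]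
        refine .all_two (d := e) ?_ ?_
        · rwa [relabel_of_not hc.2.1]
        · rwa [relabel_const]
      · rwa [relabel_const]
      · rwa [relabel_of_not hc.2.2]

/-- The labels of the sources on a trace through an inference either stay or advance. -/
def TraceLabels (r : Inference V) (ρ ρ' : Tm V 0 → Pt) (Γ : Set (Fm V 0)) : Prop :=
  ∀ φ ψ : TraceFm V, φ.toFm ∈ r.concl → ψ.toFm ∈ Γ →
    (TraceStay r φ ψ ∨ TraceSubst r φ ψ → ρ' ψ.src = ρ φ.src) ∧
      (TraceProgress r φ ψ → (ρ φ.src).Advance (ρ' ψ.src))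

theorem traceLabels_of_fresh {r : Inference V} {ρ' : Tm V 0 → Pt} {Γ : Set (Fm V 0)}
    (hs : ¬ r.IsSubst) (hr : ∀ Δ A s t c h, r ≠ .cotc Δ A s t c h)
    (hρ : ∀ φ : TraceFm V, φ.toFm ∈ r.concl → ρ' φ.src = ρ φ.src) : TraceLabels r ρ ρ' Γ := by
  refine fun φ ψ hφ _ => ⟨?_, ?_⟩
  · rintro (⟨-, rfl⟩ | ⟨σ, Δ, rfl, -⟩)
    · exact hρ _ hφ
    · exact absurd trivial hs
  · rintro ⟨Δ, c, h, h', -⟩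
    exact absurd h' (hr _ _ _ _ _ _)

theorem refutes_insert {Γ Δ : Set (Fm V 0)} {A B : Fm V 0}
    (hΔ : ∀ C ∈ insert B Γ, Refuted a b p ρ C) (hA : Refuted a b p ρ A) (h : Δ = insert A Γ) :
    ∀ C ∈ Δ, Refuted a b p ρ C := by
  subst h
  rintro C (rfl | hC)
  · exact hA
  · exact hΔ C (.inr hC)

theorem Inference.exists_refuted_premiss (hab : a ≠ b) (r : Inference V)
    (hr : ∀ A ∈ r.concl, Refuted a b p ρ A) :
    ∃ (i : ℕ) (Γ : Set (Fm V 0)) (ρ' : Tm V 0 → Pt), r.prems[i]? = some Γ ∧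
      (∀ A ∈ Γ, Refuted a b p ρ' A) ∧ TraceLabels r ρ ρ' Γ := by
  cases r with
  | idPred Γ q t =>
    cases hr _ (.inl rfl)
    cases hr _ (.inr (.inl rfl))
    contradiction
  | idRel Γ c s t =>
    cases hr _ (.inr (.inl rfl)) with
    | nrel h =>
      cases hr _ (.inl rfl) with
      | rel h' => exact absurd h h'
      -- If the two symbols coincided, an edge atom could be refuted together with its negation.
      | rel_empty => exact absurd rfl hab
  | or₀ Γ A B =>
    cases hr _ (.inl rfl) with
    | or hA hB =>
      exact ⟨0, _, ρ, rfl, refutes_insert hr hA rfl,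
        traceLabels_of_fresh id (by simp) fun _ _ => rfl⟩
  | or₁ Γ A B =>
    cases hr _ (.inl rfl) with
    | or hA hB =>
      exact ⟨0, _, ρ, rfl, refutes_insert hr hB rfl,
        traceLabels_of_fresh id (by simp) fun _ _ => rfl⟩
  | and Γ A B =>
    cases hr _ (.inl rfl) with
    | and_left hA =>
      exact ⟨0, _, ρ, rfl, refutes_insert hr hA rfl,
        traceLabels_of_fresh id (by simp) fun _ _ => rfl⟩
    | and_right hB =>
      exact ⟨1, _, ρ, rfl, refutes_insert hr hB rfl,
        traceLabels_of_fresh id (by simp) fun _ _ => rfl⟩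
  | ex Γ A t =>
    exact ⟨0, _, ρ, rfl, refutes_insert hr ((hr _ (.inl rfl)).ex_inst t) rfl,
      traceLabels_of_fresh id (by simp) fun _ _ => rfl⟩
  | all Γ A c fresh =>
    obtain ⟨d, hd⟩ := (hr _ (.inl rfl)).all_inst (fresh _ (.inl rfl))
    refine ⟨0, _, relabel ρ c d, rfl,
      refutes_insert (fun C hC => (hr C hC).relabel (fresh C hC) d) hd rfl,
      traceLabels_of_fresh id (by simp) fun φ hφ => ?_⟩
    exact relabel_of_not fun h => fresh _ hφ (.inr (.inl h))
  | wk Γ Γ' =>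
    exact ⟨0, _, ρ, rfl, fun C hC => hr C (.inl hC),
      traceLabels_of_fresh id (by simp) fun _ _ => rfl⟩
  -- No clause refutes an equation or an inequation, so the equality rules have no refuted
  -- conclusion.
  | eqRefl Γ t => cases hr _ (.inl rfl)
  | neq₀ Γ A s t => cases hr _ (.inl rfl)
  | neq₁ Γ A s t => cases hr _ (.inl rfl)
  | subst σ Γ =>
    refine ⟨0, _, fun t => ρ (t.act σ), rfl, fun C hC => (hr _ ⟨C, hC, rfl⟩).of_act, ?_⟩
    refine fun φ ψ _ _ => ⟨?_, ?_⟩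
    · rintro (⟨h, -⟩ | ⟨σ', Γ', h, -, h', -⟩)
      · exact absurd trivial h
      · cases h
        exact congrArg ρ h'
    · rintro ⟨_, _, _, h, -⟩
      cases h
  | tc₀ Γ A s t =>
    exact ⟨0, _, ρ, rfl, refutes_insert hr (hr _ (.inl rfl)).tc_inst₂ rfl,
      traceLabels_of_fresh id (by simp) fun _ _ => rfl⟩
  | tc₁ Γ A s u t =>
    rcases (hr _ (.inl rfl)).tc_step u with h | h
    · exact ⟨0, _, ρ, rfl, refutes_insert hr h rfl,
        traceLabels_of_fresh id (by simp) fun _ _ => rfl⟩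
    · exact ⟨1, _, ρ, rfl, refutes_insert hr h rfl,
        traceLabels_of_fresh id (by simp) fun _ _ => rfl⟩
  | cotc Γ A s t c fresh =>
    have hA := hr _ (.inl rfl)
    rcases hA.cotc_step (fresh _ (.inl rfl)) with h | ⟨d, hadv, h, h'⟩
    · refine ⟨0, _, ρ, rfl, refutes_insert hr h rfl, fun φ ψ _ hψ => ⟨?_, ?_⟩⟩
      · rintro (⟨-, rfl⟩ | ⟨_, _, h, -⟩)
        · rfl
        · cases h
      · rintro ⟨_, _, _, h, rfl⟩
        obtain ⟨B, s', t'⟩ := φ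
        cases h
        -- No trace progresses into the left premiss: its new formula is a conjunction, and the
        -- context cannot contain the fresh eigenvariable.
        rcases hψ with hψ | hψ
        · cases hA
          cases hψ
        · exact absurd (Or.inr (.inl rfl)) (fresh _ (.inr hψ))
    · refine ⟨1, _, relabel ρ c d, rfl, ?_, fun φ ψ hφ _ => ⟨?_, ?_⟩⟩
      · rintro C (rfl | rfl | hC)
        · exact h
        · exact h'
        · exact (hr C (.inr hC)).relabel (fresh C (.inr hC)) d
      · rintro (⟨-, rfl⟩ | ⟨_, _, h, -⟩)
        · exact relabel_of_not fun h => fresh _ hφ (.inr (.inl h))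
        · cases h
      · rintro ⟨_, _, _, h, rfl⟩
        cases h
        rwa [relabel_const]

end Propagation

/-! ### Unprovability -/

section Unprovability

variable {V : Vocab}

/-- Regularity is used only here: finitely many sub-preproofs have finitely many conclusions, so
their individual bounds have a common one. -/
theorem Preproof.Regular.exists_cut_bound {P : Preproof V} (hP : P.Regular) (a b : V.Rel)
    (p : V.Pr) : ∃ K, ∀ w r, P.infer w = some r → ∀ ρ : Tm V 0 → Pt,
      (∀ A ∈ r.concl, Refuted a b p ρ A) →
        ∃ m ≤ K, ∃ q, ∀ A ∈ r.concl, Refuted a b p (fun t => (ρ t).cut m q) A := by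
  have hfin : {Γ | ∃ w r, P.infer w = some r ∧ Γ = r.concl}.Finite := by
    refine ((hP.image fun T => (T []).map Inference.concl).preimage
      (Option.some_injective _).injOn).subset ?_
    rintro _ ⟨w, r, hw, rfl⟩
    exact ⟨_, ⟨w, by simp [hw], rfl⟩, by simp [hw]⟩
  choose! f hf using fun (Γ : Set (Fm V 0)) (hΓ : Γ.Finite) => _root_.exists_cut_bound a b p hΓ
  obtain ⟨K, hK⟩ := (hfin.image f).bddAbove
  refine ⟨K, fun w r hw ρ hρ => ?_⟩
  obtain ⟨m, hm, hq⟩ := hf _ (P.finite w r hw) ρ hρ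
  exact ⟨m, hm.trans (hK ⟨_, ⟨w, r, hw, rfl⟩, rfl⟩), hq⟩

/-- A node of a preproof with a labelling that refutes its sequent, and with labels on the ray
bounded by `K`. -/
structure RefutedNode (P : Preproof V) (a b : V.Rel) (p : V.Pr) (K : ℕ) where
  addr : List ℕ
  inf : Inference V
  label : Tm V 0 → Pt
  infer_eq : P.infer addr = some inf
  refuted : ∀ A ∈ inf.concl, Refuted a b p label A
  bounded : ∀ t n, label t = .ray n → n ≤ K

/-- Pass to a refuted premiss, then cut. The step may push a label past `K`, and the cut restores
the bound without raising any rank. -/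
theorem RefutedNode.exists_next {P : Preproof V} {a b : V.Rel} {p : V.Pr} {K : ℕ} (hab : a ≠ b)
    (hK : ∀ w r, P.infer w = some r → ∀ ρ : Tm V 0 → Pt, (∀ A ∈ r.concl, Refuted a b p ρ A) →
      ∃ m ≤ K, ∃ q, ∀ A ∈ r.concl, Refuted a b p (fun t => (ρ t).cut m q) A)
    (x : RefutedNode P a b p K) :
    ∃ (y : RefutedNode P a b p K) (i : ℕ), y.addr = x.addr ++ [i] ∧
      ∀ φ ψ : TraceFm V, φ.toFm ∈ x.inf.concl → ψ.toFm ∈ y.inf.concl →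
        (TraceStay x.inf φ ψ ∨ TraceSubst x.inf φ ψ →
          (y.label ψ.src).rank K ≤ (x.label φ.src).rank K) ∧
        (TraceProgress x.inf φ ψ → (y.label ψ.src).rank K < (x.label φ.src).rank K) := by
  obtain ⟨i, Γ, ρ, hi, hρ, htr⟩ := x.inf.exists_refuted_premiss hab x.refuted
  obtain ⟨r, hr, rfl⟩ := Option.map_eq_some_iff.1 ((P.child _ _ x.infer_eq i).trans hi)
  obtain ⟨m, hm, q, hq⟩ := hK _ r hr ρ hρ
  refine ⟨⟨x.addr ++ [i], r, _, hr, hq, fun t n h => (Pt.cut_eq_ray h).trans hm⟩, i, rfl,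
    fun φ ψ hφ hψ => ⟨fun h => ?_, fun h => ?_⟩⟩
  · rw [← (htr φ ψ hφ hψ).1 h]
    exact Pt.rank_cut_le _ _ _ _
  · exact (Pt.rank_cut_le _ _ _ _).trans_lt
      (((htr φ ψ hφ hψ).2 h).rank_lt fun n hn => x.bounded _ n hn)

theorem not_forall_infinitely_often_lt {α : Type*} [Preorder α] [WellFoundedLT α] {f : ℕ → α}
    {k : ℕ} (hle : ∀ i ≥ k, f (i + 1) ≤ f i) :
    ¬ ∀ m, ∃ i ≥ m, k ≤ i ∧ f (i + 1) < f i := by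
  intro h
  have hanti : ∀ i ≥ k, ∀ j ≥ i, f j ≤ f i := fun i hi j hj => by
    induction j, hj using Nat.le_induction with
    | base => exact le_rfl
    | succ j hj ih => exact (hle j (hi.trans hj)).trans ih
  obtain ⟨_, ⟨i, hi, rfl⟩, hmin⟩ :=
    WellFounded.has_min (wellFounded_lt (α := α)) (f '' Set.Ici k) ⟨_, k, Set.mem_Ici.2 le_rfl, rfl⟩
  obtain ⟨j, hj, hkj, hlt⟩ := h i
  exact hmin _ ⟨j + 1, hkj.trans (Nat.le_succ j), rfl⟩ (hlt.trans_le (hanti i hi j hj))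

/-- Iterating `RefutedNode.exists_next` gives an infinite branch. The ranks of the sources on any
trace along it form a non-increasing sequence in a well-order, so they drop only finitely often. -/
theorem Preproof.not_isProof_of_refuted {P : Preproof V} (hP : P.Regular) {a b : V.Rel}
    (hab : a ≠ b) {p : V.Pr} {r₀ : Inference V} (h₀ : P.infer [] = some r₀) {ρ : Tm V 0 → Pt}
    (hρ : ∀ A ∈ r₀.concl, Refuted a b p ρ A) : ¬ P.IsProof := by
  intro hproof
  obtain ⟨K, hK⟩ := hP.exists_cut_bound a b p
  obtain ⟨m, hm, q, hq⟩ := hK _ r₀ h₀ ρ hρ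
  let x₀ : RefutedNode P a b p K :=
    ⟨[], r₀, _, h₀, hq, fun t n h => (Pt.cut_eq_ray h).trans hm⟩
  choose next idx haddr htrace using RefutedNode.exists_next hab hK
  let x : ℕ → RefutedNode P a b p K := fun n => next^[n] x₀
  have hx : ∀ n, x (n + 1) = next (x n) := fun n => Function.iterate_succ_apply' next n x₀
  have hbranch : P.IsBranch (fun n => idx (x n)) fun n => (x n).inf := by
    intro n
    rw [← (x n).infer_eq]
    congr 1
    induction n with
    | zero => rfl
    | succ n ih => rw [List.range_succ, List.map_append, ih, hx, haddr, List.map_singleton]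
  obtain ⟨k, φ, hφ, hinf⟩ := hproof _ _ hbranch
  have hstep : ∀ i ≥ k, _ := fun i hi =>
    htrace (x i) (φ i) (φ (i + 1)) (hφ i hi).1 (hx i ▸ (hφ (i + 1) (Nat.le_succ_of_le hi)).1)
  refine not_forall_infinitely_often_lt (f := fun i => ((x i).label (φ i).src).rank K) (k := k)
    (fun i hi => ?_) fun m => ?_
  · rw [hx]
    rcases (hφ i hi).2 with h | h | h
    · exact (hstep i hi).1 (.inl h)
    · exact ((hstep i hi).2 h).le
    · exact (hstep i hi).1 (.inr h)
  · obtain ⟨i, hi, hki, h⟩ := hinf m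
    refine ⟨i, hi, hki, ?_⟩
    rw [hx]
    exact (hstep i hki).2 h

theorem refuted_counterexample (a b : V.Rel) (p : V.Pr) (t : Tm V 0) :
    Refuted a b p (fun _ => .ray 0) ((counterexample a b p).st t) :=
  .or (.all_cotc rfl) (.ex_path rfl)

end Unprovability

theorem mainTheorem3 (V : Vocab) (a b : V.Rel) (hab : a ≠ b) (p : V.Pr) :
    PDLFm.Valid.{u} (counterexample a b p) ∧
      ∀ t : Tm V 0, ¬ CyclicProvable ((counterexample a b p).st t) := by
  refine ⟨counterexample_valid a b p, ?_⟩
  rintro t ⟨P, hconcl, hproof, hreg⟩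
  obtain ⟨r, hr, hΓ⟩ := Option.map_eq_some_iff.1 hconcl
  refine P.not_isProof_of_refuted hreg hab (p := p) hr (ρ := fun _ => .ray 0) ?_ hproof
  rw [hΓ]
  rintro _ rfl
  exact refuted_counterexample a b p t
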